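/- All graphs are finite and simple. For a graph $G$ and a half-integer $r=s/2\ge 0$ ($s\in\mathbb{N}$), put $d=\lceil r\rceil$. A graph $G'$ is a shallow minor of $G$ at depth $r$ if there are pairwise disjoint sets $B_i\subseteq V(G)$ with centers $x_i\in B_i$, for $i\in V(G')$, such that every vertex of $B_i$ is at distance at most $d$ from $x_i$ in $G[B_i]$, and such that for every edge $ij$ of $G'$ there is an edge $uv$ of $G$ with $u\in B_i$, $v\in B_j$, where, if $r$ is not an integer, moreover $\mathrm{dist}_{G[B_i]}(x_i,u)<d$ or $\mathrm{dist}_{G[B_j]}(x_j,v)<d$. Let $\nabla_r(G)$ be the maximum of $|E(G')|/|V(G')|$ over the nonempty shallow minors $G'$ of $G$ at depth $r$ (and $0$ if there are none). A $t$-fraternity function on a finite set $\mathcal V$ is a function $\omega:\mathcal V\times\mathcal V\to\{1,2,3,\dots\}\cup\{\infty\}$ such that for all $x,y$ at least one of $\omega(x,y),\omega(y,x)$ is $\infty$, and for all $x\ne y$, with $m=\min(\omega(x,y),\omega(y,x))$ and $\mu=\min_{z\in\mathcal V\setminus\{x,y\}}(\omega(z,x)+\omega(z,y))$ (where $\min\emptyset=\infty$),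 one has $m=1$, or $m=\mu$, or both $m>t$ and $\mu>t$. A directed weighted graph $\vec G$ forms a $t$-fraternity function $\omega$ on its vertex set if its arcs are the pairs $(u,v)$ with $\omega(u,v)\le t$, the weight of $(u,v)$ being $\omega(u,v)$. A $t$-fraternal extension of a graph $F$ is a directed weighted graph on $V(F)$ that forms a $t$-fraternity function and whose arcs of weight $1$ form an orientation of $F$. It is an optimal acyclic $t$-fraternal extension of $F$ if for every $1\le i\le t$ the arcs of weight $i$ form a degeneracy orientation of the undirected graph of the edges of weight $i$, that is, an acyclic orientation whose maximum outdegree equals the degeneracy of that undirected graph (the least $\kappa$ such that every nonempty subgraph has a vertex of degree at most $\kappa$). Let $t\ge 1$ be an integer and let $C\ge 0$ be a real number. There is a constant $\Delta$, depending only on $t$ and $C$, such that for every graph $F$ with $\nabla_{(t-1)/2}(F)\le C$, every optimal acyclic $t$-fraternal extension of $F$ has maximum outdegree at most $\Delta$ (counting the arcs of all weights). -/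

import Mathlib

open scoped ENNReal NNReal

/-- `IsShallowMinor s G' G`: the graph `G'` is a shallow minor of `G` at depth `s / 2`, where `s` is
a natural number, so that the depth ranges over integers and half-integers. Put `d = ⌈s / 2⌉`, that
is `s / 2 = d` for `s` even and `s / 2 = d - 1 / 2` for `s` odd. The vertices `i` of `G'` are
represented by disjoint sets `B i` of vertices of `G`, each with a center `x i` from which every
vertex of `B i` is at distance at most `d` in the graph induced on `B i`; every edge `i j` of `G'` is
witnessed by an (external) edge `u v` of `G` with `u ∈ B i` and `v ∈ B j`; and at half-integer depth,
one of the ends of this external edge is at distance strictly less than `d` from its center. -/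
def IsShallowMinor {W V : Type*} (s : ℕ) (G' : SimpleGraph W) (G : SimpleGraph V) : Prop :=
  ∃ (B : W → Set V) (x : ∀ i, B i),
    (∀ i j, i ≠ j → Disjoint (B i) (B j)) ∧
    (∀ (i : W) (v : B i), (G.induce (B i)).edist (x i) v ≤ ((s + 1) / 2 : ℕ)) ∧
    ∀ i j, G'.Adj i j → ∃ (u : B i) (v : B j), G.Adj u v ∧
      (Odd s → (G.induce (B i)).edist (x i) u < ((s + 1) / 2 : ℕ) ∨
        (G.induce (B j)).edist (x j) v < ((s + 1) / 2 : ℕ))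

/-- The greatest reduced average density `∇_{s/2}(G)` of rank `s / 2`: the supremum of
`|E(G')| / |V(G')|` over the (finite, nonempty) shallow minors `G'` of `G` at depth `s / 2`. -/
noncomputable def grad {V : Type*} (s : ℕ) (G : SimpleGraph V) : ℝ≥0∞ :=
  ⨆ (p : ℕ) (G' : SimpleGraph (Fin (p + 1))) (_ : IsShallowMinor s G' G),
    (Nat.card G'.edgeSet : ℝ≥0∞) / ((p + 1 : ℕ) : ℝ≥0∞)

/-- `G` is `κ`-degenerate: every (nonempty) subgraph has minimum degree at most `κ`. -/
def IsDegenerate {V : Type*} (G : SimpleGraph V) (κ : ℕ∞) : Prop :=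
  ∀ H : G.Subgraph, H.verts.Nonempty → ∃ v ∈ H.verts, (H.neighborSet v).encard ≤ κ

/-- The degeneracy of `G`: the least `κ` such that `G` is `κ`-degenerate. -/
noncomputable def degeneracy {V : Type*} (G : SimpleGraph V) : ℕ∞ :=
  sInf {κ | IsDegenerate G κ}

/-- The maximum outdegree `Δ⁺` of a directed graph. -/
noncomputable def maxOutDegree {V : Type*} (D : Digraph V) : ℕ∞ :=
  ⨆ v, {w | D.Adj v w}.encard

/-- A directed graph without directed cycles (in particular without loops). -/
def IsAcyclicDigraph {V : Type*} (D : Digraph V) : Prop :=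
  ∀ v, ¬ Relation.TransGen D.Adj v v

/-- `D` is an orientation of `G`: each edge of `G` gets exactly one of its two directions, and `D`
has no other arcs. -/
def IsOrientation {V : Type*} (D : Digraph V) (G : SimpleGraph V) : Prop :=
  (∀ u v, G.Adj u v ↔ D.Adj u v ∨ D.Adj v u) ∧ ∀ u v, ¬ (D.Adj u v ∧ D.Adj v u)

/-- `D` is a degeneracy orientation of `G`: an acyclic orientation whose maximum outdegree is the
degeneracy of `G`. -/
def IsDegeneracyOrientation {V : Type*} (D : Digraph V) (G : SimpleGraph V) : Prop :=
  IsOrientation D G ∧ IsAcyclicDigraph D ∧ maxOutDegree D = degeneracy G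

/-- A directed weighted graph: a directed graph and a weight for each arc. The values of `weight` on
pairs that are not arcs carry no meaning. -/
structure WeightedDigraph (V : Type*) extends Digraph V where
  weight : V → V → ℕ

/-- The directed graph of the arcs of weight `i`. -/
def WeightedDigraph.layer {V : Type*} (M : WeightedDigraph V) (i : ℕ) : Digraph V where
  Adj u v := M.Adj u v ∧ M.weight u v = i

/-- `ω` is a `t`-fraternity function: its values are positive integers or `∞`, one of `ω x y` and
`ω y x` is `∞`, and each pair `x ≠ y` satisfies one of the three alternatives (a minimum over no
vertex `z` is `∞`). -/
structure IsFraternityFunction {V : Type*} (t : ℕ) (ω : V → V → ℕ∞) : Prop where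
  pos : ∀ x y, 1 ≤ ω x y
  eq_top : ∀ x y, ω x y = ⊤ ∨ ω y x = ⊤
  frat : ∀ x y, x ≠ y →
    min (ω x y) (ω y x) = 1 ∨
    min (ω x y) (ω y x) = (⨅ z ∈ ({x, y} : Set V)ᶜ, (ω z x + ω z y)) ∨
    ((t : ℕ∞) < min (ω x y) (ω y x) ∧ (t : ℕ∞) < ⨅ z ∈ ({x, y} : Set V)ᶜ, (ω z x + ω z y))

/-- `M` forms a `t`-fraternity function: for some `t`-fraternity function `ω`, the arcs of `M` are
the pairs with `ω u v ≤ t`, with weight `ω u v`. -/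
def FormsFraternityFunction {V : Type*} (t : ℕ) (M : WeightedDigraph V) : Prop :=
  ∃ ω : V → V → ℕ∞, IsFraternityFunction t ω ∧
    (∀ u v, M.Adj u v ↔ ω u v ≤ t) ∧ ∀ u v, M.Adj u v → (M.weight u v : ℕ∞) = ω u v

/-- `M` is a `t`-fraternal extension of the directed graph `D`. -/
def IsFraternalExtensionOfDigraph {V : Type*} (t : ℕ) (D : Digraph V) (M : WeightedDigraph V) :
    Prop :=
  FormsFraternityFunction t M ∧ D = M.layer 1

/-- `M` is a `t`-fraternal extension of the undirected graph `F`: it is one of some orientation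
of `F`. -/
def IsFraternalExtension {V : Type*} (t : ℕ) (F : SimpleGraph V) (M : WeightedDigraph V) : Prop :=
  ∃ D : Digraph V, IsOrientation D F ∧ IsFraternalExtensionOfDigraph t D M

/-- `M` is an optimal acyclic `t`-fraternal extension of `F`: for every `i ∈ [1, t]`, the arcs of
weight `i` form a degeneracy orientation of the undirected graph of the edges of weight `i`. -/
def IsOptimalAcyclicFraternalExtension {V : Type*} (t : ℕ) (F : SimpleGraph V)
    (M : WeightedDigraph V) : Prop :=
  IsFraternalExtension t F M ∧
    ∀ i, 1 ≤ i → i ≤ t →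
      IsDegeneracyOrientation (M.layer i) (M.layer i).toSimpleGraphInclusive

/-! ### Shallow minors from internally disjoint paths -/

/-! The number of out-arcs of weight below `i` is bounded by induction on `i`. Unfolding the
fraternity condition turns an arc of weight `i` into a walk of length at most `i` in `F`, each of
whose internal vertices reaches both ends in at most `i` arcs of weight below `i`
(`IsFraternityFunction.exists_walk`). By induction a vertex reaches at most some `N` vertices in
this way, so it is internal to at most `N * N` of the walks.

Given arcs of weight `i` inside `A`, drop those whose path meets `A` internally and thin the rest to
an internally disjoint family; both losses are bounded (`card_arcs_le_of_walks`). Cutting the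
surviving paths near the middle gives a shallow minor at depth `(t - 1) / 2`, so their number is at
most `c * A.card`. Hence layer `i` is sparse on every vertex set, its degeneracy is bounded, and a
degeneracy orientation turns this into an outdegree bound. -/

theorem card_edgeSet_div_le_grad {V W : Type*} [Fintype W] [Nonempty W] {s : ℕ}
    {G : SimpleGraph V} {G' : SimpleGraph W} (h : IsShallowMinor s G' G) :
    (Nat.card G'.edgeSet : ℝ≥0∞) / (Fintype.card W : ℝ≥0∞) ≤ grad s G := by
  obtain ⟨p, hp⟩ : ∃ p, Fintype.card W = p + 1 :=
    Nat.exists_eq_succ_of_ne_zero Fintype.card_ne_zero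
  let φ : Fin (p + 1) ≃ W := (Fintype.equivFinOfCardEq hp).symm
  have hminor : IsShallowMinor s (G'.comap φ) G := by
    obtain ⟨B, x, hdisj, hdist, hadj⟩ := h
    exact ⟨fun i => B (φ i), fun i => x (φ i), fun i j hij => hdisj _ _ (φ.injective.ne hij),
      fun i v => hdist _ v, fun i j hij => hadj _ _ hij⟩
  have hcard : Nat.card (G'.comap φ).edgeSet = Nat.card G'.edgeSet :=
    Nat.card_congr (SimpleGraph.Iso.comap φ G').mapEdgeSet
  rw [hp, ← hcard]
  exact le_iSup_of_le p (le_iSup_of_le (G'.comap φ) (le_iSup_of_le hminor le_rfl))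

theorem edist_induce_le_of_adj {V : Type*} {G : SimpleGraph V} {B : Set V} (f : ℕ → V) (k : ℕ)
    (hB : ∀ j ≤ k, f j ∈ B) (hadj : ∀ j < k, G.Adj (f j) (f (j + 1))) :
    (G.induce B).edist ⟨f 0, hB 0 (Nat.zero_le k)⟩ ⟨f k, hB k le_rfl⟩ ≤ k := by
  induction k with
  | zero => simp
  | succ k ih =>
    have h := ih (fun j hj => hB j (by omega)) (fun j hj => hadj j (by omega))
    have h1 : (G.induce B).edist ⟨f k, hB k (by omega)⟩ ⟨f (k + 1), hB (k + 1) le_rfl⟩ ≤ 1 := by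
      have : (G.induce B).Adj ⟨f k, hB k (by omega)⟩ ⟨f (k + 1), hB (k + 1) le_rfl⟩ := by
        simpa using hadj k (by omega)
      exact (SimpleGraph.edist_eq_one_iff_adj.2 this).le
    refine SimpleGraph.edist_triangle.trans ((add_le_add h h1).trans ?_)
    push_cast
    exact le_rfl

/-- Paths `f e` of length `ℓ e ≤ t`, joining the ends of the arcs `e ∈ S` on the vertex set `A`,
that avoid `A` internally and are internally disjoint. -/
structure IsInternallyDisjointPathSystem {V : Type*} (F : SimpleGraph V) (t : ℕ) (A : Finset V)
    (S : Finset (V × V)) (f : V × V → ℕ → V) (ℓ : V × V → ℕ) : Prop where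
  start : ∀ e ∈ S, f e 0 = e.1
  finish : ∀ e ∈ S, f e (ℓ e) = e.2
  length_le : ∀ e ∈ S, ℓ e ≤ t
  adj : ∀ e ∈ S, ∀ j < ℓ e, F.Adj (f e j) (f e (j + 1))
  avoid : ∀ e ∈ S, ∀ j, 0 < j → j < ℓ e → f e j ∉ A
  inj : ∀ e ∈ S, ∀ e' ∈ S, ∀ j j', 0 < j → j < ℓ e → 0 < j' → j' < ℓ e' → f e j = f e' j' →
    e = e' ∧ j = j'

/-- The branch set of `a`: the first `t / 2` internal vertices of the paths that start at `a`, and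
the later ones of those that end at `a`. -/
def branchSet {V : Type*} (t : ℕ) (S : Finset (V × V)) (f : V × V → ℕ → V) (ℓ : V × V → ℕ)
    (a : V) : Set V :=
  {v | v = a ∨ ∃ e ∈ S, ∃ j, 0 < j ∧ j < ℓ e ∧ v = f e j ∧
    (e.1 = a ∧ j ≤ t / 2 ∨ e.2 = a ∧ t / 2 < j)}

namespace IsInternallyDisjointPathSystem

variable {V : Type*} {F : SimpleGraph V} {t : ℕ} {A : Finset V} {S : Finset (V × V)}
  {f : V × V → ℕ → V} {ℓ : V × V → ℕ}

theorem disjoint_branchSet (h : IsInternallyDisjointPathSystem F t A S f ℓ) {a b : V}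
    (ha : a ∈ A) (hb : b ∈ A) (hab : a ≠ b) :
    Disjoint (branchSet t S f ℓ a) (branchSet t S f ℓ b) := by
  rw [Set.disjoint_left]
  rintro v (rfl | ⟨e, he, j, hj, hjl, rfl, hside⟩) (hv | ⟨e', he', j', hj', hjl', hv, hside'⟩)
  · exact hab hv
  · exact h.avoid e' he' j' hj' hjl' (hv ▸ ha)
  · exact h.avoid e he j hj hjl (hv ▸ hb)
  · obtain ⟨rfl, rfl⟩ := h.inj e he e' he' j j' hj hjl hj' hjl' hv
    rcases hside with ⟨h1, h2⟩ | ⟨h1, h2⟩ <;> rcases hside' with ⟨h3, h4⟩ | ⟨h3, h4⟩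
    · exact hab (h1.symm.trans h3)
    · omega
    · omega
    · exact hab (h1.symm.trans h3)

theorem exists_edist_fst_le (h : IsInternallyDisjointPathSystem F t A S f ℓ) {e : V × V}
    (he : e ∈ S) {j : ℕ} (hjl : j < ℓ e) (hjt : j ≤ t / 2) :
    ∃ hv : f e j ∈ branchSet t S f ℓ e.1,
      (F.induce (branchSet t S f ℓ e.1)).edist ⟨e.1, Or.inl rfl⟩ ⟨f e j, hv⟩ ≤ j := by
  have hB : ∀ k ≤ j, f e k ∈ branchSet t S f ℓ e.1 := by
    intro k hk
    rcases Nat.eq_zero_or_pos k with rfl | hk0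
    · exact Or.inl (h.start e he)
    · exact Or.inr ⟨e, he, k, hk0, by omega, rfl, Or.inl ⟨rfl, by omega⟩⟩
  have key := edist_induce_le_of_adj (G := F) (f e) j hB (fun k hk => h.adj e he k (by omega))
  refine ⟨hB j le_rfl, ?_⟩
  simpa only [h.start e he] using key

/-- The alternative `j = ℓ e` serves paths so short that all their internal vertices belong to the
source. -/
theorem exists_edist_snd_le (h : IsInternallyDisjointPathSystem F t A S f ℓ) {e : V × V}
    (he : e ∈ S) {j : ℕ} (hj0 : 0 < j) (hjl : j ≤ ℓ e) (hjt : t / 2 < j ∨ j = ℓ e) :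
    ∃ hv : f e j ∈ branchSet t S f ℓ e.2,
      (F.induce (branchSet t S f ℓ e.2)).edist ⟨e.2, Or.inl rfl⟩ ⟨f e j, hv⟩ ≤ (ℓ e - j : ℕ) := by
  have hB : ∀ k ≤ ℓ e - j, f e (ℓ e - k) ∈ branchSet t S f ℓ e.2 := by
    intro k hk
    rcases Nat.eq_zero_or_pos k with rfl | hk0
    · exact Or.inl (h.finish e he)
    · exact Or.inr ⟨e, he, ℓ e - k, by omega, by omega, rfl, Or.inr ⟨rfl, by omega⟩⟩
  have key := edist_induce_le_of_adj (G := F) (fun k => f e (ℓ e - k)) (ℓ e - j) hB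
    (fun k hk => by
      have := h.adj e he (ℓ e - (k + 1)) (by omega)
      rw [show ℓ e - (k + 1) + 1 = ℓ e - k by omega] at this
      exact this.symm)
  have hlast : ℓ e - (ℓ e - j) = j := by omega
  have hmem := hB _ le_rfl
  rw [hlast] at hmem
  refine ⟨hmem, ?_⟩
  simpa only [Nat.sub_zero, h.finish e he, hlast] using key

/-- The undirected graph on `A` with edges `S`. -/
def arcGraph (A : Finset V) (S : Finset (V × V)) (hne : ∀ e ∈ S, e.1 ≠ e.2) : SimpleGraph A where
  Adj a b := ((a : V), (b : V)) ∈ S ∨ ((b : V), (a : V)) ∈ S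
  symm := ⟨fun _ _ h => h.symm⟩
  loopless := ⟨fun _ h => hne _ (h.elim id id) rfl⟩

theorem isShallowMinor (h : IsInternallyDisjointPathSystem F t A S f ℓ) (ht : 1 ≤ t)
    (hne : ∀ e ∈ S, e.1 ≠ e.2) : IsShallowMinor (t - 1) (arcGraph A S hne) F := by
  have hd : (t - 1 + 1) / 2 = t / 2 := by rw [Nat.sub_add_cancel ht]
  have hpos : ∀ e ∈ S, 0 < ℓ e := by
    intro e he
    rcases Nat.eq_zero_or_pos (ℓ e) with h0 | h0
    · exact absurd (((h.start e he).symm.trans (by rw [h0])).trans (h.finish e he)) (hne e he)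
    · exact h0
  have hedge : ∀ e ∈ S, ∃ (u : branchSet t S f ℓ e.1) (v : branchSet t S f ℓ e.2), F.Adj u v ∧
      (Odd (t - 1) →
        (F.induce (branchSet t S f ℓ e.2)).edist ⟨e.2, Or.inl rfl⟩ v < (t / 2 : ℕ)) := by
    intro e he
    have hl := hpos e he
    have hlt := h.length_le e he
    -- The path leaves the source's branch set after position `t / 2`, or just before its end if it
    -- is shorter; the next edge is the external one.
    obtain ⟨hu, -⟩ := h.exists_edist_fst_le he (j := min (t / 2) (ℓ e - 1)) (by omega) (by omega)
    obtain ⟨hv, hv'⟩ := h.exists_edist_snd_le he (j := min (t / 2) (ℓ e - 1) + 1) (by omega)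
      (by omega) (by omega)
    refine ⟨⟨_, hu⟩, ⟨_, hv⟩, h.adj e he _ (by omega), fun hodd => hv'.trans_lt ?_⟩
    -- Here `t` is even, so at most `t - (t / 2 + 1) < t / 2` steps remain on the target's side.
    obtain ⟨k, hk⟩ := hodd
    exact_mod_cast (by omega : ℓ e - (min (t / 2) (ℓ e - 1) + 1) < t / 2)
  refine ⟨fun a => branchSet t S f ℓ a, fun a => ⟨a, Or.inl rfl⟩, ?_, ?_, ?_⟩
  · intro a b hab
    exact h.disjoint_branchSet a.2 b.2 (fun hh => hab (Subtype.ext hh))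
  · rw [hd]
    rintro ⟨a, ha⟩ ⟨v, hv⟩
    rcases id hv with rfl | ⟨e, he, j, hj, hjl, rfl, ⟨rfl, hjt⟩ | ⟨rfl, hjt⟩⟩
    · simp
    · obtain ⟨_, hv'⟩ := h.exists_edist_fst_le he hjl hjt
      exact hv'.trans (by exact_mod_cast hjt)
    · obtain ⟨_, hv'⟩ := h.exists_edist_snd_le he hj hjl.le (Or.inl hjt)
      have := h.length_le e he
      exact hv'.trans (by exact_mod_cast (by omega : ℓ e - j ≤ t / 2))
  · rw [hd]
    rintro ⟨a, ha⟩ ⟨b, hb⟩ (hab | hab)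
    · obtain ⟨u, v, huv, hodd⟩ := hedge _ hab
      exact ⟨u, v, huv, fun ho => Or.inr (hodd ho)⟩
    · obtain ⟨u, v, huv, hodd⟩ := hedge _ hab
      exact ⟨v, u, huv.symm, fun ho => Or.inl (hodd ho)⟩

theorem card_le_grad_mul (h : IsInternallyDisjointPathSystem F t A S f ℓ) (ht : 1 ≤ t)
    (hA : ∀ e ∈ S, e.1 ∈ A ∧ e.2 ∈ A) (hne : ∀ e ∈ S, e.1 ≠ e.2)
    (hanti : ∀ a b, (a, b) ∈ S → (b, a) ∉ S) :
    (S.card : ℝ≥0∞) ≤ grad (t - 1) F * (A.card : ℝ≥0∞) := by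
  rcases A.eq_empty_or_nonempty with rfl | hAne
  · have : S = ∅ := Finset.eq_empty_of_forall_notMem fun e he => by simpa using (hA e he).1
    simp [this]
  have : Nonempty A := hAne.to_subtype
  have hle := card_edgeSet_div_le_grad (h.isShallowMinor ht hne)
  have hcard : S.card ≤ Nat.card (arcGraph A S hne).edgeSet := by
    let g : S → (arcGraph A S hne).edgeSet := fun e =>
      ⟨s(⟨e.1.1, (hA e.1 e.2).1⟩, ⟨e.1.2, (hA e.1 e.2).2⟩), Or.inl e.2⟩
    have hg : Function.Injective g := by
      rintro ⟨⟨a, b⟩, he⟩ ⟨⟨a', b'⟩, he'⟩ heq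
      have heq' := congrArg Subtype.val heq
      simp only [g, Sym2.eq_iff, Subtype.mk.injEq] at heq'
      rcases heq' with ⟨rfl, rfl⟩ | ⟨rfl, rfl⟩
      · rfl
      · exact absurd he' (hanti _ _ he)
    simpa using Nat.card_le_card_of_injective g hg
  rw [Fintype.card_coe] at hle
  refine le_trans (by exact_mod_cast hcard) ((ENNReal.div_le_iff ?_ ?_).1 hle)
  · simpa using hAne.ne_empty
  · simp

end IsInternallyDisjointPathSystem


/-! ### Selecting internally disjoint paths -/

/-- A largest independent `T` works: by maximality every element of `S` is related to a member of
`T`, and each member accounts for at most `k` elements. -/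
theorem exists_independent_subset {α : Type*} (S : Finset α) (r : α → α → Prop) [DecidableRel r]
    (hrefl : ∀ a, r a a) (hsymm : ∀ a b, r a b → r b a) (k : ℕ)
    (hk : ∀ a ∈ S, (S.filter (r a)).card ≤ k) :
    ∃ T ⊆ S, (∀ a ∈ T, ∀ b ∈ T, r a b → a = b) ∧ S.card ≤ T.card * k := by
  classical
  obtain ⟨T, hT, hmax⟩ :=
    (S.powerset.filter fun T => ∀ a ∈ T, ∀ b ∈ T, r a b → a = b).exists_max_image Finset.card
      ⟨∅, by simp⟩
  simp only [Finset.mem_filter, Finset.mem_powerset] at hT hmax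
  refine ⟨T, hT.1, hT.2, ?_⟩
  have hcover : S ⊆ T.biUnion fun a => S.filter (r a) := by
    intro b hb
    simp only [Finset.mem_biUnion, Finset.mem_filter]
    by_contra! hcon
    have hbT : b ∉ T := fun hbT => hcon b hbT hb (hrefl b)
    have := hmax (insert b T) ⟨Finset.insert_subset hb hT.1, by
      intro a ha a' ha' haa'
      rcases Finset.mem_insert.1 ha with rfl | haT <;>
        rcases Finset.mem_insert.1 ha' with rfl | haT'
      · rfl
      · exact absurd (hsymm _ _ haa') (hcon a' haT' hb)
      · exact absurd haa' (hcon a haT hb)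
      · exact hT.2 a haT a' haT' haa'⟩
    rw [Finset.card_insert_of_notMem hbT] at this
    omega
  exact (Finset.card_le_card hcover).trans
    (Finset.card_biUnion_le_card_mul _ _ _ fun a ha => hk a (hT.1 ha))

/-- A walk can be replaced by a path, presented as a sequence of vertices, whose internal vertices
are on the walk. -/
theorem exists_path_sequence {V : Type*} {F : SimpleGraph V} {x y : V} (p : F.Walk x y) :
    ∃ (f : ℕ → V) (ℓ : ℕ), f 0 = x ∧ f ℓ = y ∧ ℓ ≤ p.length ∧
      (∀ j < ℓ, F.Adj (f j) (f (j + 1))) ∧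
      (∀ j, 0 < j → j < ℓ → f j ∈ p.support ∧ f j ≠ x ∧ f j ≠ y) ∧
      ∀ j ≤ ℓ, ∀ j' ≤ ℓ, f j = f j' → j = j' := by
  classical
  have hinj := p.bypass_isPath.getVert_injOn
  refine ⟨p.bypass.getVert, p.bypass.length, by simp, by simp, p.length_bypass_le_length,
    fun j hj => p.bypass.adj_getVert_succ hj, fun j hj0 hj => ⟨?_, fun hx => ?_, fun hy => ?_⟩,
    fun j hj j' hj' hjj' => hinj hj hj' hjj'⟩
  · exact p.support_bypass_subset_support (p.bypass.getVert_mem_support j)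
  · have := hinj (x₁ := j) (x₂ := 0) hj.le (Nat.zero_le _) (by simpa using hx)
    omega
  · have := hinj (x₁ := j) (x₂ := p.bypass.length) hj.le (le_refl p.bypass.length)
      (by simpa using hy)
    omega

/-- If every arc of `S` is realized by a short walk, and the internal vertices `w` of these walks
have the ends of the arc in a small set `R w`, then the number of arcs is linear in the number of
vertices. -/
theorem card_arcs_le_of_walks {V : Type*} {F : SimpleGraph V} {t c N : ℕ} (ht : 1 ≤ t)
    (hgrad : grad (t - 1) F ≤ (c : ℝ≥0∞)) (R : V → Finset V) (hR : ∀ w, (R w).card ≤ N)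
    (A : Finset V) (S : Finset (V × V)) (hA : ∀ e ∈ S, e.1 ∈ A ∧ e.2 ∈ A)
    (hne : ∀ e ∈ S, e.1 ≠ e.2) (hanti : ∀ a b, (a, b) ∈ S → (b, a) ∉ S)
    (hwalk : ∀ e ∈ S, ∃ p : F.Walk e.1 e.2, p.length ≤ t ∧
      ∀ w ∈ p.support, w = e.1 ∨ w = e.2 ∨ e.1 ∈ R w ∧ e.2 ∈ R w) :
    S.card ≤ (N * N + c * (1 + t * (N * N))) * A.card := by
  classical
  rcases S.eq_empty_or_nonempty with rfl | ⟨e₀, -⟩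
  · simp
  have : Nonempty V := ⟨e₀.1⟩
  have hseq : ∀ e ∈ S, ∃ (f : ℕ → V) (ℓ : ℕ), f 0 = e.1 ∧ f ℓ = e.2 ∧ ℓ ≤ t ∧
      (∀ j < ℓ, F.Adj (f j) (f (j + 1))) ∧
      (∀ j, 0 < j → j < ℓ → e ∈ R (f j) ×ˢ R (f j)) ∧
      ∀ j ≤ ℓ, ∀ j' ≤ ℓ, f j = f j' → j = j' := by
    intro e he
    obtain ⟨p, hpt, hp⟩ := hwalk e he
    obtain ⟨f, ℓ, h0, h1, hl, hadj, hint, hinj⟩ := exists_path_sequence p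
    refine ⟨f, ℓ, h0, h1, hl.trans hpt, hadj, fun j hj hjl => ?_, hinj⟩
    obtain ⟨hs, hx, hy⟩ := hint j hj hjl
    rw [Finset.mem_product]
    exact ((hp _ hs).resolve_left hx).resolve_left hy
  choose! f ℓ hstart hfinish hlen hadj hint hinj using hseq
  let I : V × V → Finset V := fun e => (Finset.Ioo 0 (ℓ e)).image (f e)
  have hI : ∀ e ∈ S, ∀ w ∈ I e, e ∈ R w ×ˢ R w := by
    intro e he w hw
    obtain ⟨j, hj, rfl⟩ := Finset.mem_image.1 hw
    rw [Finset.mem_Ioo] at hj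
    exact hint e he j hj.1 hj.2
  have hRR : ∀ w, (R w ×ˢ R w).card ≤ N * N := fun w => by
    rw [Finset.card_product]
    exact Nat.mul_le_mul (hR w) (hR w)
  have hIcard : ∀ e ∈ S, (I e).card ≤ t := by
    intro e he
    refine Finset.card_image_le.trans ?_
    rw [Nat.card_Ioo]
    have := hlen e he
    omega
  let bad := S.filter fun e => ∃ w ∈ I e, w ∈ A
  let good := S.filter fun e => ¬ ∃ w ∈ I e, w ∈ A
  have hsplit : bad.card + good.card = S.card := Finset.card_filter_add_card_filter_not _
  -- Charge each bad arc to a vertex of `A` inside its path.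
  have hbad : bad.card ≤ A.card * (N * N) := by
    refine (Finset.card_le_card (t := A.biUnion fun w => R w ×ˢ R w) ?_).trans
      (Finset.card_biUnion_le_card_mul _ _ _ fun w _ => hRR w)
    intro e he
    obtain ⟨heS, w, hw, hwA⟩ := Finset.mem_filter.1 he
    exact Finset.mem_biUnion.2 ⟨w, hwA, hI e heS w hw⟩
  have hgoodS : good ⊆ S := Finset.filter_subset _ _
  -- An arc conflicts with itself and, through each of its at most `t` internal vertices, with at
  -- most `N * N` arcs.
  obtain ⟨T, hTgood, hTind, hTcard⟩ := exists_independent_subset good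
    (fun e e' => e = e' ∨ ∃ w ∈ I e, w ∈ I e') (fun _ => Or.inl rfl)
    (fun a b h => h.imp Eq.symm fun ⟨w, h1, h2⟩ => ⟨w, h2, h1⟩) (1 + t * (N * N)) (by
      intro e he
      refine (Finset.card_le_card (t := {e} ∪ (I e).biUnion fun w => R w ×ˢ R w) ?_).trans
        ((Finset.card_union_le _ _).trans (Nat.add_le_add (Finset.card_singleton e).le
          ((Finset.card_biUnion_le_card_mul _ _ _ fun w _ => hRR w).trans
            (Nat.mul_le_mul_right _ (hIcard e (hgoodS he))))))
      intro e' he'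
      obtain ⟨heS, rfl | ⟨w, hw, hw'⟩⟩ := Finset.mem_filter.1 he'
      · simp
      · exact Finset.mem_union_right _
          (Finset.mem_biUnion.2 ⟨w, hw, hI e' (hgoodS heS) w hw'⟩))
  have hTS : ∀ e ∈ T, e ∈ S := fun e he => hgoodS (hTgood he)
  have hmemI : ∀ e j, 0 < j → j < ℓ e → f e j ∈ I e := fun e j hj hjl =>
    Finset.mem_image_of_mem _ (Finset.mem_Ioo.2 ⟨hj, hjl⟩)
  have hsys : IsInternallyDisjointPathSystem F t A T f ℓ :=
    { start := fun e he => hstart e (hTS e he)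
      finish := fun e he => hfinish e (hTS e he)
      length_le := fun e he => hlen e (hTS e he)
      adj := fun e he => hadj e (hTS e he)
      avoid := fun e he j hj hjl hjA =>
        (Finset.mem_filter.1 (hTgood he)).2 ⟨_, hmemI e j hj hjl, hjA⟩
      inj := by
        intro e he e' he' j j' hj hjl hj' hjl' heq
        obtain rfl := hTind e he e' he'
          (Or.inr ⟨_, hmemI e j hj hjl, heq ▸ hmemI e' j' hj' hjl'⟩)
        exact ⟨rfl, hinj e (hTS e he) j hjl.le j' hjl'.le heq⟩ }
  have hTle : T.card ≤ c * A.card := by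
    have := (hsys.card_le_grad_mul ht (fun e he => hA e (hTS e he)) (fun e he => hne e (hTS e he))
      (fun a b hab hba => hanti a b (hTS _ hab) (hTS _ hba))).trans (mul_le_mul_left hgrad _)
    exact_mod_cast this
  calc S.card = bad.card + good.card := hsplit.symm
    _ ≤ A.card * (N * N) + c * A.card * (1 + t * (N * N)) :=
      Nat.add_le_add hbad (hTcard.trans (Nat.mul_le_mul_right _ hTle))
    _ = _ := by ring

/-! ### Degeneracy from density -/

/-- Double counting: if all degrees in a subgraph on `A` exceeded `2 * K`, it would have more than
`2 * K * A.card` ordered adjacent pairs, while each such pair is an arc or a reversed arc. -/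
theorem degeneracy_toSimpleGraphInclusive_le {V : Type*} [Finite V] (D : Digraph V) (K : ℕ)
    (hK : ∀ (A : Finset V) (S : Finset (V × V)), (∀ e ∈ S, e.1 ∈ A ∧ e.2 ∈ A) →
      (∀ e ∈ S, D.Adj e.1 e.2) → S.card ≤ K * A.card) :
    degeneracy D.toSimpleGraphInclusive ≤ (2 * K : ℕ) := by
  classical
  have := Fintype.ofFinite V
  refine sInf_le fun H hH => ?_
  by_contra! hcon
  let A : Finset V := H.verts.toFinset
  let S : Finset (V × V) := Finset.univ.filter fun e => H.Adj e.1 e.2 ∧ D.Adj e.1 e.2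
  have hS := hK A S
    (fun e he => by
      have := (Finset.mem_filter.1 he).2.1
      exact ⟨by simpa [A] using H.edge_vert this, by simpa [A] using H.edge_vert this.symm⟩)
    (fun e he => (Finset.mem_filter.1 he).2.2)
  let P : Finset (V × V) := Finset.univ.filter fun e => H.Adj e.1 e.2
  have hP : P.card ≤ S.card + S.card := by
    have hsub : P ⊆ S ∪ S.image Prod.swap := by
      rintro ⟨a, b⟩ hab
      have hab' : H.Adj a b := (Finset.mem_filter.1 hab).2
      have hD := hab'.adj_sub
      rw [Digraph.toSimpleGraphInclusive, SimpleGraph.fromRel_adj] at hD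
      rcases hD.2 with h | h
      · exact Finset.mem_union_left _ (by simpa [S] using ⟨hab', h⟩)
      · exact Finset.mem_union_right _
          (Finset.mem_image.2 ⟨(b, a), by simpa [S] using ⟨hab'.symm, h⟩, rfl⟩)
    exact (Finset.card_le_card hsub).trans ((Finset.card_union_le _ _).trans
      (Nat.add_le_add_left Finset.card_image_le _))
  have hPge : A.card * (2 * K + 1) ≤ P.card := by
    have hmaps : Set.MapsTo Prod.fst (P : Set (V × V)) (A : Set V) := fun e he => by
      simpa [A] using H.edge_vert (Finset.mem_filter.1 he).2
    rw [Finset.card_eq_sum_card_fiberwise hmaps, ← smul_eq_mul]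
    refine Finset.card_nsmul_le_sum _ _ _ fun v hv => ?_
    have hdeg := hcon v (by simpa [A] using hv)
    rw [← Set.coe_toFinset (H.neighborSet v), Set.encard_coe_eq_coe_finsetCard] at hdeg
    have hdeg' : 2 * K < (H.neighborSet v).toFinset.card := by exact_mod_cast hdeg
    refine hdeg'.trans_le (Finset.card_le_card_of_injOn (Prod.mk v) (fun w hw => ?_)
      (fun w _ w' _ hww' => (Prod.mk.inj hww').2))
    simpa [P] using hw
  have hApos : 0 < A.card := Finset.card_pos.2 (by simpa [A] using hH)
  nlinarith

/-! ### Walks realizing the arcs of a fraternal extension -/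

/-- The vertices reached from a vertex in at most `k` steps along `out`. -/
def outReach {V : Type*} [DecidableEq V] (out : V → Finset V) : ℕ → V → Finset V
  | 0, v => {v}
  | k + 1, v => (outReach out k v).biUnion fun u => insert u (out u)

section outReach

variable {V : Type*} [DecidableEq V] {out : V → Finset V}

theorem card_outReach_le {Δ : ℕ} (h : ∀ v, (out v).card ≤ Δ) (k : ℕ) (v : V) :
    (outReach out k v).card ≤ (Δ + 1) ^ k := by
  induction k with
  | zero => simp [outReach]
  | succ k ih =>
    rw [outReach, pow_succ]
    exact (Finset.card_biUnion_le_card_mul _ _ _ fun u _ =>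
      (Finset.card_insert_le _ _).trans (Nat.succ_le_succ (h u))).trans (Nat.mul_le_mul_right _ ih)

theorem outReach_mono {v : V} : Monotone fun k => outReach out k v :=
  monotone_nat_of_le_succ fun _ u hu =>
    Finset.mem_biUnion.2 ⟨u, hu, Finset.mem_insert_self _ _⟩

theorem mem_outReach_succ {k : ℕ} {u v w : V} (hu : u ∈ outReach out k v) (hw : w ∈ out u) :
    w ∈ outReach out (k + 1) v :=
  Finset.mem_biUnion.2 ⟨u, hu, Finset.mem_insert_of_mem hw⟩

theorem self_mem_outReach {k : ℕ} {v : V} : v ∈ outReach out k v :=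
  outReach_mono (Nat.zero_le k) (by simp [outReach])

end outReach

theorem IsFraternityFunction.ne_of_ne_top {V : Type*} {t : ℕ} {ω : V → V → ℕ∞}
    (h : IsFraternityFunction t ω) {x y : V} (hxy : ω x y ≠ ⊤) : x ≠ y := by
  rintro rfl
  exact hxy (by simpa using h.eq_top x x)

/-- A pair of weight `a` in `[2, t]` has a common in-neighbour realizing its weight. -/
theorem IsFraternityFunction.exists_apex {V : Type*} {t : ℕ} {ω : V → V → ℕ∞}
    (h : IsFraternityFunction t ω) {x y : V} {a : ℕ} (hxy : ω x y = a) (h2 : 2 ≤ a)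
    (hat : a ≤ t) : ∃ (z : V) (b c : ℕ), ω z x = b ∧ ω z y = c ∧ 1 ≤ b ∧ 1 ≤ c ∧ b + c ≤ a := by
  have hyx : ω y x = ⊤ := (h.eq_top x y).resolve_left (by simp [hxy])
  have hfrat := h.frat x y (h.ne_of_ne_top (by simp [hxy]))
  rw [hyx, hxy, min_eq_left le_top] at hfrat
  -- Since `2 ≤ a ≤ t`, only the middle alternative survives. The strict bound by `a + 1` lets a
  -- witness `z` be extracted from the infimum.
  have hinf : (⨅ z ∈ ({x, y} : Set V)ᶜ, (ω z x + ω z y)) < ((a + 1 : ℕ) : ℕ∞) := by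
    rcases hfrat with h1 | h1 | h1
    · norm_cast at h1
      omega
    · rw [← h1]
      exact_mod_cast Nat.lt_succ_self a
    · exact absurd h1.1 (not_lt.2 (by exact_mod_cast hat))
  simp only [iInf_lt_iff] at hinf
  obtain ⟨z, -, hz⟩ := hinf
  have hx := h.pos z x
  have hy := h.pos z y
  obtain ⟨n, hn⟩ := ENat.ne_top_iff_exists.1 hz.ne_top
  have hb : ω z x ≠ ⊤ := fun hh => by simp [hh] at hn
  have hc : ω z y ≠ ⊤ := fun hh => by simp [hh] at hn
  obtain ⟨b, hb⟩ := ENat.ne_top_iff_exists.1 hb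
  obtain ⟨c, hc⟩ := ENat.ne_top_iff_exists.1 hc
  rw [← hb] at hx
  rw [← hc] at hy
  rw [← hb, ← hc] at hz
  norm_cast at hx hy hz
  exact ⟨z, b, c, hb.symm, hc.symm, hx, hy, by omega⟩

/-- An arc of weight `a` is realized by a walk of length at most `a`, and both ends of the arc are
reached from each internal vertex of the walk along arcs of smaller weight. -/
theorem IsFraternityFunction.exists_walk {V : Type*} [DecidableEq V] {t : ℕ} {ω : V → V → ℕ∞}
    (h : IsFraternityFunction t ω) {F : SimpleGraph V} (hF : ∀ x y, ω x y = 1 → F.Adj x y)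
    {i : ℕ} (hit : i ≤ t) {out : V → Finset V} (hout : ∀ u v, ω u v < i → v ∈ out u) (a : ℕ) :
    a ≤ i → ∀ x y, ω x y = a → ∃ p : F.Walk x y, p.length ≤ a ∧
      ∀ w ∈ p.support, w = x ∨ w = y ∨ x ∈ outReach out a w ∧ y ∈ outReach out a w := by
  induction a using Nat.strong_induction_on with
  | _ a ih =>
  intro hai x y hxy
  have ha1 : 1 ≤ a := by
    have := h.pos x y
    rw [hxy] at this
    exact_mod_cast this
  rcases eq_or_lt_of_le ha1 with rfl | h2
  · refine ⟨(hF x y (by simpa using hxy)).toWalk, by simp, fun w hw => ?_⟩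
    simp only [SimpleGraph.Walk.support_cons, SimpleGraph.Walk.support_nil, List.mem_cons,
      List.not_mem_nil, or_false] at hw
    exact hw.imp id Or.inl
  obtain ⟨z, b, c, hb, hc, hb1, hc1, hbc⟩ := h.exists_apex hxy h2 (hai.trans hit)
  obtain ⟨p, hpl, hp⟩ := ih b (by omega) (by omega) z x hb
  obtain ⟨q, hql, hq⟩ := ih c (by omega) (by omega) z y hc
  have hzx : x ∈ out z := hout z x (by rw [hb]; exact_mod_cast (by omega : b < i))
  have hzy : y ∈ out z := hout z y (by rw [hc]; exact_mod_cast (by omega : c < i))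
  have hz : x ∈ outReach out a z ∧ y ∈ outReach out a z :=
    ⟨outReach_mono ha1 (mem_outReach_succ self_mem_outReach hzx),
      outReach_mono ha1 (mem_outReach_succ self_mem_outReach hzy)⟩
  refine ⟨p.reverse.append q, ?_, fun w hw => ?_⟩
  · rw [SimpleGraph.Walk.length_append, SimpleGraph.Walk.length_reverse]
    omega
  rw [SimpleGraph.Walk.mem_support_append_iff, SimpleGraph.Walk.support_reverse,
    List.mem_reverse] at hw
  rcases hw with hw | hw
  · rcases hp w hw with rfl | rfl | ⟨h1, h3⟩
    · exact Or.inr (Or.inr hz)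
    · exact Or.inl rfl
    -- From `w`, go to `z` in `b` steps and then along the arc to `y`; `b + 1 ≤ a` because `c ≥ 1`.
    · exact Or.inr (Or.inr ⟨outReach_mono (by omega) h3,
        outReach_mono (by omega : b + 1 ≤ a) (mem_outReach_succ h1 hzy)⟩)
  · rcases hq w hw with rfl | rfl | ⟨h1, h3⟩
    · exact Or.inr (Or.inr hz)
    · exact Or.inr (Or.inl rfl)
    · exact Or.inr (Or.inr ⟨outReach_mono (by omega : c + 1 ≤ a) (mem_outReach_succ h1 hzx),
        outReach_mono (by omega) h3⟩)

/-! ### The outdegree bound -/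

/-- A bound on the outdegree in weights below `i`, in terms of `t` and of an integer bound `c` on
the density of shallow minors. -/
def fraternalOutBound (t c : ℕ) : ℕ → ℕ
  | 0 => 0
  | i + 1 =>
    let N := (fraternalOutBound t c i + 1) ^ i
    fraternalOutBound t c i + 2 * (N * N + c * (1 + t * (N * N)))

/-- In the recursion `N` bounds the vertices reached in `i` steps, and the factor 2 comes from
passing from density to degeneracy. -/
theorem encard_out_le_fraternalOutBound {V : Type*} [Finite V] {t c : ℕ} (ht : 1 ≤ t)
    {F : SimpleGraph V} (hgrad : grad (t - 1) F ≤ (c : ℝ≥0∞)) {M : WeightedDigraph V}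
    (hM : IsOptimalAcyclicFraternalExtension t F M) {ω : V → V → ℕ∞}
    (hω : IsFraternityFunction t ω) (hadj : ∀ u v, M.Adj u v ↔ ω u v ≤ t)
    (hweight : ∀ u v, M.Adj u v → (M.weight u v : ℕ∞) = ω u v)
    (hF : ∀ x y, ω x y = 1 → F.Adj x y) (i : ℕ) :
    i ≤ t + 1 → ∀ v, {w | ω v w < i}.encard ≤ fraternalOutBound t c i := by
  classical
  have := Fintype.ofFinite V
  induction i with
  | zero => simp
  | succ i ih =>
    intro hi v
    specialize ih (by omega)
    have hsplit : {w | ω v w < (i + 1 : ℕ)} ⊆ {w | ω v w < i} ∪ {w | ω v w = i} := by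
      intro w hw
      have hw' : ω v w < (i : ℕ∞) + 1 := by simpa using hw
      exact lt_or_eq_of_le (Order.le_of_lt_add_one hw')
    have hlayer : {w | ω v w = i} ⊆ {w | (M.layer i).Adj v w} := by
      intro w (hw : ω v w = i)
      have hMadj : M.Adj v w := (hadj v w).2 (by rw [hw]; exact_mod_cast (by omega : i ≤ t))
      refine ⟨hMadj, ?_⟩
      have := hweight v w hMadj
      rw [hw] at this
      exact_mod_cast this
    have hlayer' : ∀ x y, (M.layer i).Adj x y → ω x y = i := fun x y hxy => by
      rw [← hweight x y hxy.1, hxy.2]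
    -- Optimality says nothing about weight 0, but no arc has that weight.
    rcases Nat.eq_zero_or_pos i with rfl | hi0
    · have : {w | ω v w < (0 + 1 : ℕ)} = ∅ := by
        ext w
        simpa using (zero_lt_one.trans_le (hω.pos v w)).ne'
      rw [this]
      simp
    let out : V → Finset V := fun u => {w | ω u w < i}.toFinset
    have hout : ∀ u, (out u).card ≤ fraternalOutBound t c i := fun u => by
      have := ih u
      rw [← Set.coe_toFinset {w | ω u w < i}, Set.encard_coe_eq_coe_finsetCard] at this
      exact_mod_cast this
    have hdeg : {w | (M.layer i).Adj v w}.encard ≤ _ :=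
      (le_iSup (fun v => {w | (M.layer i).Adj v w}.encard) v).trans
        ((hM.2 i hi0 (by omega)).2.2.le.trans
          (degeneracy_toSimpleGraphInclusive_le (M.layer i) _ fun A S hA hS =>
            card_arcs_le_of_walks ht hgrad (outReach out i) (card_outReach_le hout i) A S hA
              (fun e he => hω.ne_of_ne_top (by simp [hlayer' _ _ (hS e he)]))
              (fun a b hab hba => by
                have h1 := hlayer' _ _ (hS _ hab)
                have h2 := hlayer' _ _ (hS _ hba)
                rcases hω.eq_top a b with h | h <;> simp_all)
              (fun e he => by
                obtain ⟨p, hp, hp'⟩ := hω.exists_walk hF (by omega : i ≤ t) (out := out)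
                  (fun u v huv => by simpa [out] using huv) i le_rfl e.1 e.2
                  (hlayer' _ _ (hS e he))
                exact ⟨p, hp.trans (by omega), hp'⟩)))
    calc {w | ω v w < (i + 1 : ℕ)}.encard
        ≤ {w | ω v w < i}.encard + {w | (M.layer i).Adj v w}.encard :=
          (Set.encard_le_encard (hsplit.trans (Set.union_subset_union_right _ hlayer))).trans
            (Set.encard_union_le _ _)
      _ ≤ _ := add_le_add (ih v) hdeg
      _ = fraternalOutBound t c (i + 1) := by
        rw [fraternalOutBound]
        push_cast
        rfl

theorem mainTheorem5 (t : ℕ) (ht : 1 ≤ t) (C : ℝ≥0) :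
    ∃ Δ : ℕ, ∀ (V : Type*) [Finite V] (F : SimpleGraph V),
      grad (t - 1) F ≤ (C : ℝ≥0∞) →
      ∀ M : WeightedDigraph V, IsOptimalAcyclicFraternalExtension t F M →
        maxOutDegree M.toDigraph ≤ (Δ : ℕ∞) := by
  -- The bound concerns weights strictly below its index, hence `t + 1`.
  refine ⟨fraternalOutBound t ⌈C⌉₊ (t + 1), fun V _ F hF M hM => iSup_le fun v => ?_⟩
  obtain ⟨D, hD, ⟨ω, hω, hadj, hweight⟩, rfl⟩ := hM.1
  have hgrad : grad (t - 1) F ≤ ((⌈C⌉₊ : ℕ) : ℝ≥0∞) :=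
    hF.trans (by exact_mod_cast Nat.le_ceil C)
  have hone : ∀ x y, ω x y = 1 → F.Adj x y := fun x y hxy => by
    have hMadj : M.Adj x y := (hadj x y).2 (by rw [hxy]; exact_mod_cast ht)
    refine (hD.1 x y).2 (Or.inl ⟨hMadj, ?_⟩)
    have := hweight x y hMadj
    rw [hxy] at this
    exact_mod_cast this
  refine (Set.encard_le_encard fun w (hw : M.Adj v w) => ?_).trans
    (encard_out_le_fraternalOutBound ht hgrad hM hω hadj hweight hone (t + 1) le_rfl v)
  exact ((hadj v w).1 hw).trans_lt (by exact_mod_cast Nat.lt_succ_self t)
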